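/- **Model.** Fix $k\ge 2$ sites $S_1,\dots,S_k$, a coordinator, and a universe $U=\{1,\dots,u\}$, $u\ge 1$. Items of $U$ (repetitions allowed) arrive one at a time, each at exactly one site. A deterministic protocol specifies states and deterministic transitions of the sites and of the coordinator. When a site receives an item it updates its state and may send a message to the coordinator; the coordinator may then carry out a finite adaptive exchange in which it sends messages to sites and receives their answers. This communication is instantaneous, i.e. complete before the next item arrives. A site knows only its own items and the messages sent to it, the coordinator only the messages sent to it; sites do not communicate with each other directly. A message is a finite sequence of words; during the arrival of the first $n$ items every word sent is an integer in $[0,\max(u,n)]$. The communication cost is the total number of words sent in both directions, every message counting as at least one word. For a finite multiset $A$ over $U$, the rank $r_A(x)$ of $x\in U$ is the number of items of $A$ smaller than $x$. For $0\le\phi\le1$, a $\phi$-quantile of $A$ is an $x\in U$ such that at most $\phi|A|$ items of $A$ are smaller than $x$ and at most $(1-\phi)|A|$ are greater than $x$; an $\varepsilon$-approximate $\phi$-quantile of $A$ is a $\phi'$-quantile of $A$ for some $\phi'\in[0,1]$ with $\phi-\varepsilon\le\phi'\le\phi+\varepsilon$. **Theorem (all-quantiles tracking).** There is an absolute constant $C>0$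 such that for all $k\ge2$, $u\ge1$ and $0<\varepsilon\le\frac12$ there is a deterministic protocol (not knowing the length of the stream in advance) with the following properties for every stream. At all times, if $A$ is the multiset of the items that have arrived so far, the coordinator's state determines, without further communication, - for every $\phi\in[0,1]$ simultaneously, an $\varepsilon$-approximate $\phi$-quantile of $A$, and - for every $x\in U$, a number $\tilde r(x)$ with $|\tilde r(x)-r_A(x)|\le\varepsilon|A|$. Moreover, for every $n\ge2$, the total communication cost during the arrival of the first $n$ items is at most $$C\cdot\frac{k}{\varepsilon}\cdot\log n\cdot\log^2\frac1\varepsilon .$$ -/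

import Mathlib

namespace DistStream

/-- A message is a finite sequence of words; a word is a natural number (the admissible size of
words is bounded in `WordsFit`). -/
abbrev Msg := List ℕ

/-- The communication cost of a message, in words. Even a message without content costs one. -/
def Msg.cost (w : Msg) : ℕ := max 1 (List.length w)

/-- The total cost, in words, of a sequence of messages. -/
def totalCost (T : List Msg) : ℕ := (T.map Msg.cost).sum

/-- A terminating piece of communication driven by the coordinator, who either stops, in a new
state of type `Γ`, or sends a message to one site `j` and then continues depending on that site's
answer (`none`: the site does not answer). -/
inductive Dialogue (k : ℕ) (Γ : Type) : Type where
  | done (c : Γ) : Dialogue k Γ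
  | send (j : Fin k) (w : Msg) (next : Option Msg → Dialogue k Γ) : Dialogue k Γ

/-- A deterministic protocol in the distributed streaming model with `k` sites, one coordinator and
the ordered universe `Fin u`. The coordinator sees nothing but the messages sent to it, a site
nothing but its own items and the messages sent to it, and sites do not talk to each other.
The last two fields are the queries that the coordinator answers from its state alone. -/
structure Protocol (k u : ℕ) where
  /-- local states of the sites -/
  Site : Type
  /-- states of the coordinator -/
  Coord : Type
  siteInit : Fin k → Site
  coordInit : Coord
  /-- site `j` observes an item: its new state, and a message to the coordinator, if any -/
  observe : Fin k → Site → Fin u → Site × Option Msg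
  /-- the coordinator has received an unsolicited message from site `j` -/
  react : Coord → Fin k → Msg → Dialogue k Coord
  /-- site `j` receives a message from the coordinator: its new state, and its answer, if any -/
  answer : Fin k → Site → Msg → Site × Option Msg
  /-- estimate of the rank of an element of the universe -/
  rank : Coord → Fin u → ℝ
  /-- approximate `φ`-quantile -/
  quantile : Coord → ℝ → Fin u

namespace Protocol

variable {k u : ℕ} (P : Protocol k u)

/-- The state of the whole system, with all messages sent so far, in both directions. -/
structure Config where
  coord : P.Coord
  site : Fin k → P.Site
  sent : List Msg

def init : P.Config := ⟨P.coordInit, P.siteInit, []⟩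

/-- Carrying out a dialogue, from given states of the sites and given messages sent so far. -/
def converse : Dialogue k P.Coord → (Fin k → P.Site) → List Msg → P.Config
  | .done c, σ, T => ⟨c, σ, T⟩
  | .send j w next, σ, T =>
      converse (next (P.answer j (σ j) w).2)
        (Function.update σ j (P.answer j (σ j) w).1)
        (T ++ w :: (P.answer j (σ j) w).2.toList)

/-- Item `a.2` arrives at site `a.1`, and all communication that it triggers is carried out. -/
def step (c : P.Config) (a : Fin k × Fin u) : P.Config :=
  let r := P.observe a.1 (c.site a.1) a.2
  match r.2 with
  | none => ⟨c.coord, Function.update c.site a.1 r.1, c.sent⟩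
  | some w =>
      P.converse (P.react c.coord a.1 w) (Function.update c.site a.1 r.1) (c.sent ++ [w])

/-- The system after the arrival, in this order, of the items of `A`, each paired with the site
that observes it. -/
def run (A : List (Fin k × Fin u)) : P.Config := A.foldl P.step P.init

/-- The total communication, in words, during the arrival of `A`. -/
def cost (A : List (Fin k × Fin u)) : ℕ := totalCost (P.run A).sent

/-- Every word sent during the arrival of `n` items, in either direction, is a number between `0`
and `max u n`; so a word has `O(log u + log n)` bits. -/
def WordsFit : Prop :=
  ∀ A : List (Fin k × Fin u), ∀ w ∈ (P.run A).sent, ∀ b ∈ w, b ≤ max u A.length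

end Protocol

/-- The multiset of the items of a stream, irrespective of the sites. -/
def items {k u : ℕ} (A : List (Fin k × Fin u)) : Multiset (Fin u) := (A.map Prod.snd : List (Fin u))

/-- The rank of `x` in `M`: the number of items of `M` smaller than `x`. -/
def rankIn {u : ℕ} (M : Multiset (Fin u)) (x : Fin u) : ℕ := M.countP (fun y => y < x)

/-- `x` is a `φ`-quantile of `M`: at most `φ|M|` items are smaller than `x` and at most `(1-φ)|M|`
items are greater than `x`. -/
def IsQuantile {u : ℕ} (M : Multiset (Fin u)) (φ : ℝ) (x : Fin u) : Prop :=
  (M.countP (fun y => y < x) : ℝ) ≤ φ * M.card ∧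
    (M.countP (fun y => x < y) : ℝ) ≤ (1 - φ) * M.card

/-- `x` is an `ε`-approximate `φ`-quantile of `M`: a `φ'`-quantile for some
`φ' ∈ [φ - ε, φ + ε]`. -/
def IsApproxQuantile {u : ℕ} (ε : ℝ) (M : Multiset (Fin u)) (φ : ℝ) (x : Fin u) : Prop :=
  ∃ φ' : ℝ, 0 ≤ φ' ∧ φ' ≤ 1 ∧ φ - ε ≤ φ' ∧ φ' ≤ φ + ε ∧ IsQuantile M φ' x

namespace Protocol

variable {k u : ℕ} (P : Protocol k u)

/-- For every stream, at every time `t` (when `t` items have arrived), the state of the coordinator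
gives an `ε`-approximate `φ`-quantile of the current multiset for all `φ ∈ [0, 1]`. -/
def TracksQuantiles (ε : ℝ) : Prop :=
  ∀ A : List (Fin k × Fin u), ∀ t ≤ A.length, ∀ φ : ℝ, 0 ≤ φ → φ ≤ 1 →
    IsApproxQuantile ε (items (A.take t)) φ (P.quantile (P.run (A.take t)).coord φ)

/-- For every stream, at every time `t`, the state of the coordinator gives the rank of every
element of the universe with additive error at most `ε` times the current number of items. -/
def TracksRanks (ε : ℝ) : Prop :=
  ∀ A : List (Fin k × Fin u), ∀ t ≤ A.length, ∀ x : Fin u,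
    |P.rank (P.run (A.take t)).coord x - rankIn (items (A.take t)) x|
      ≤ ε * (items (A.take t)).card

end Protocol

end DistStream

/-!
All quantiles can be tracked without any message from the coordinator: every site, on its own,
keeps the coordinator informed about the ranks in its local stream of `n` items up to an error of
`ε n`, at a cost of `O(ε⁻¹ log² ε⁻¹ log n)` words. Both errors and costs add up over the sites.

A site organises its stream as a Fenwick tree. Write a local time `t` as `2 ^ v * o` with `o` odd.
The block of `t` consists of the last `2 ^ v` items before `t`, so the prefix of length `t` is the
prefix of length `t - 2 ^ v` followed by the block of `t`, and the odd part of `t - 2 ^ v` is at most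
`o / 2` (`oddPart_sub_lowPart_le`). With `K ≈ 3 / ε` and `D ≈ log K`, the site reports at time `t`
only if `o ≤ K`, and then sends `t` together with every `q`-th item of its sorted block, where
`q ≈ t / (K D)`. This determines ranks within the block up to `t / (K D)` (`countP_sample`).

* Accuracy (`Ledger.Tracks`): a prefix whose length `t` is a reporting time splits into at most `D`
  blocks, all of them reported, so its ranks are known up to `t / K`. At any time `n` the last
  reporting time is at least `n - 2 n / K` (`exists_oddPart_le`), so at all times ranks are known
  up to `3 n / K ≤ ε n`.
* Cost (`sum_reportCost_le`): the report at time `2 ^ v * o` has at most `1 + K D / o` words. There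
  are `log₂ n + 1` possible values of `v`, and the sum over `o ≤ K` is harmonic, whence
  `(log₂ n + 1) (K + K D (1 + log K))` words in all.

The rank estimates never exceed the true ranks. A quantile is read off from them as the largest `x`
whose estimated rank is at most `φ` times the estimated length of the stream
(`isApproxQuantile_of_rank_estimates`).
-/

namespace DistStream

/-! ### The power of two and the odd factor of a natural number -/

/-- The largest power of two that divides `t`; it is `1` for `t = 0`. -/
def lowPart (t : ℕ) : ℕ := 2 ^ t.factorization 2

/-- The largest odd divisor of `t`; it is `0` for `t = 0`. -/
def oddPart (t : ℕ) : ℕ := t / 2 ^ t.factorization 2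

lemma lowPart_pos (t : ℕ) : 0 < lowPart t := by unfold lowPart; positivity

lemma lowPart_mul_oddPart (t : ℕ) : lowPart t * oddPart t = t :=
  Nat.ordProj_mul_ordCompl_eq_self t 2

@[simp] lemma oddPart_zero : oddPart 0 = 0 := by simp [oddPart]

lemma oddPart_pos {t : ℕ} (ht : 0 < t) : 0 < oddPart t :=
  Nat.ordCompl_pos 2 ht.ne'

lemma odd_oddPart {t : ℕ} (ht : 0 < t) : Odd (oddPart t) := by
  rw [← Nat.not_even_iff_odd, even_iff_two_dvd]
  exact Nat.not_dvd_ordCompl Nat.prime_two ht.ne'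

lemma lowPart_le {t : ℕ} (ht : 0 < t) : lowPart t ≤ t := Nat.ordProj_le 2 ht.ne'

lemma oddPart_two_pow_mul_le (i m : ℕ) : oddPart (2 ^ i * m) ≤ m := by
  have h : oddPart (2 ^ i * m) = oddPart (2 ^ i) * oddPart m := Nat.ordCompl_mul _ _ _
  have h' : oddPart (2 ^ i) = 1 := by
    simp [oddPart, Nat.prime_two.factorization_self]
  rw [h, h', one_mul]
  exact Nat.ordCompl_le m 2

/-- Passing to the parent in the Fenwick tree halves the odd part, so that the chain from `t` down to
`0` has at most `Nat.log 2 (oddPart t) + 1` steps. -/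
lemma oddPart_sub_lowPart_le (t : ℕ) : oddPart (t - lowPart t) ≤ oddPart t / 2 := by
  rcases Nat.eq_zero_or_pos t with rfl | ht
  · simp
  obtain ⟨m, hm⟩ := odd_oddPart ht
  have h : t - lowPart t = 2 ^ (t.factorization 2 + 1) * m := by
    have h1 := lowPart_mul_oddPart t
    rw [hm] at h1
    have h2 : lowPart t * (2 * m + 1) = 2 ^ (t.factorization 2 + 1) * m + lowPart t := by
      unfold lowPart; ring
    omega
  rw [h, hm]
  have := oddPart_two_pow_mul_le (t.factorization 2 + 1) m
  omega

/-- Numbers with odd part at most `K` are dense: rounding `n` down to a multiple of the smallest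
`2 ^ i` with `n / 2 ^ i ≤ K` changes it by at most `2 n / K`. -/
lemma exists_oddPart_le {K : ℕ} (hK : 0 < K) (n : ℕ) :
    ∃ t ≤ n, oddPart t ≤ K ∧ K * (n - t) ≤ 2 * n := by
  have hex : ∃ i, n / 2 ^ i ≤ K := ⟨n, by
    rw [Nat.div_eq_of_lt Nat.lt_two_pow_self]; exact hK.le⟩
  classical
  set i := Nat.find hex with hi
  have hle : n / 2 ^ i ≤ K := Nat.find_spec hex
  refine ⟨2 ^ i * (n / 2 ^ i), Nat.mul_div_le _ _, (oddPart_two_pow_mul_le _ _).trans hle, ?_⟩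
  have hsub : n - 2 ^ i * (n / 2 ^ i) = n % 2 ^ i := by
    have := Nat.div_add_mod n (2 ^ i); omega
  rw [hsub]
  rcases Nat.eq_zero_or_pos i with h0 | h0
  · simp [h0, Nat.mod_one]
  · obtain ⟨m, hm⟩ : ∃ m, i = m + 1 := ⟨i - 1, by omega⟩
    have hlt : K < n / 2 ^ m := not_le.mp (Nat.find_min hex (by omega))
    have h1 : K * 2 ^ m ≤ n :=
      (Nat.mul_le_mul_right _ hlt.le).trans (Nat.div_mul_le_self _ _)
    calc K * (n % 2 ^ i) ≤ K * 2 ^ i := by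
          gcongr; exact (Nat.mod_lt _ (by positivity)).le
      _ = 2 * (K * 2 ^ m) := by rw [hm]; ring
      _ ≤ 2 * n := by omega

/-! ### Sampling a sorted block -/

/-- Every `q`-th item of `b` in increasing order, that is, the items at the (zero-based) positions
`q - 1, 2 * q - 1, …` of the sorted list. All these positions exist, so the default `0` is never
used. -/
def sample (q : ℕ) (b : List ℕ) : List ℕ :=
  (List.range (b.length / q)).map fun i => (b.mergeSort (· ≤ ·)).getD ((i + 1) * q - 1) 0

lemma length_sample (q : ℕ) (b : List ℕ) : (sample q b).length = b.length / q := by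
  simp [sample]

lemma sorted_getD_lt_iff {s : List ℕ} (hs : s.Pairwise (· ≤ ·)) (x p : ℕ) (hp : p < s.length) :
    s.getD p 0 < x ↔ p < s.countP (· < x) := by
  induction s generalizing p with
  | nil => simp at hp
  | cons a s ih =>
    rw [List.pairwise_cons] at hs
    by_cases hax : a < x
    · cases p with
      | zero => simp [hax]
      | succ p =>
        have := ih hs.2 p (by simpa using hp)
        simpa [hax] using this
    · have h0 : s.countP (· < x) = 0 := by
        rw [List.countP_eq_zero]
        intro y hy
        have := hs.1 y hy
        simp; omega
      cases p with
      | zero => simp [hax, h0]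
      | succ p =>
        have := ih hs.2 p (by simpa using hp)
        simpa [hax, h0] using this

lemma countP_lt_range (m n : ℕ) : (List.range n).countP (· < m) = min m n := by
  induction n with
  | zero => simp
  | succ n ih =>
    rw [List.range_succ, List.countP_append, ih]
    by_cases h : n < m
    · simp [h]; omega
    · simp [h]; omega

/-- A sample determines ranks up to `q - 1`, always from below. -/
lemma countP_sample {q : ℕ} (hq : 0 < q) (b : List ℕ) (x : ℕ) :
    (sample q b).countP (· < x) = b.countP (· < x) / q := by
  set s := b.mergeSort (· ≤ ·) with hs
  have hperm : s.Perm b := List.mergeSort_perm b _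
  have hsorted : s.Pairwise (· ≤ ·) := by
    simpa using List.pairwise_mergeSort' (· ≤ ·) b
  have hlen : s.length = b.length := hperm.length_eq
  have hcount : s.countP (· < x) = b.countP (· < x) := hperm.countP_eq _
  have hle : b.countP (· < x) / q ≤ b.length / q := Nat.div_le_div_right List.countP_le_length
  rw [sample, List.countP_map, ← min_eq_left hle, ← countP_lt_range]
  apply List.countP_congr
  intro i hi
  rw [List.mem_range] at hi
  have h1 : (i + 1) * q ≤ b.length := (Nat.le_div_iff_mul_le hq).1 hi
  have h2 : 0 < (i + 1) * q := by positivity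
  have h3 := sorted_getD_lt_iff hsorted x ((i + 1) * q - 1) (by omega)
  have h4 : (i + 1 ≤ b.countP (· < x) / q) ↔ (i + 1) * q ≤ b.countP (· < x) :=
    Nat.le_div_iff_mul_le hq
  simp only [Function.comp_apply, decide_eq_true_eq]
  rw [← hs, h3, hcount]
  omega

lemma mem_sample {q : ℕ} {b : List ℕ} {N y : ℕ} (hb : ∀ z ∈ b, z ≤ N) (hy : y ∈ sample q b) :
    y ≤ N := by
  obtain ⟨i, -, rfl⟩ := List.mem_map.1 hy
  by_cases h : (i + 1) * q - 1 < (b.mergeSort (· ≤ ·)).length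
  · rw [List.getD_eq_getElem _ _ h]
    exact hb _ ((List.mergeSort_perm b _).mem_iff.1 (List.getElem_mem h))
  · rw [List.getD_eq_default _ _ (by omega)]
    exact Nat.zero_le _

/-! ### Reports of a single site -/

/-- An upper bound on the number of blocks that make up a prefix whose length has odd part at most
`K`. -/
def depth (K : ℕ) : ℕ := Nat.log 2 K + 1

/-- The sampling step in the report at local time `t`, chosen such that rounding loses at most
`t / (K * depth K)` per block. -/
def grain (K t : ℕ) : ℕ := t / (K * depth K) + 1

/-- The message of a site whose local stream has just become `l`: the local time, followed by a sample
of the block of that time. Nothing is sent if the odd part of the time exceeds `K`. -/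
def report (K : ℕ) (l : List ℕ) : Option Msg :=
  if oddPart l.length ≤ K then
    some (l.length :: sample (grain K l.length) (l.drop (l.length - lowPart l.length)))
  else none

/-- What the coordinator knows about the local stream of one site: the time `last` of the last report,
and for each reporting time `t` an estimate `est t x` of the rank of `x` among the first `t` items. -/
structure Ledger where
  last : ℕ
  est : ℕ → ℕ → ℕ

/-- Entering a report into the ledger: the estimate for the parent prefix is extended by the sampled
block. -/
def Ledger.receive (K : ℕ) (r : Ledger) : Msg → Ledger
  | [] => r
  | t :: w => ⟨t, Function.update r.est t
      fun x => r.est (t - lowPart t) x + grain K t * w.countP (· < x)⟩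

/-- The ledger `r` is up to date with the local stream `l`. Its estimates for reporting times `t` are
lower bounds, with an error of at most `t / (K * depth K)` for each block of the prefix. -/
structure Ledger.Tracks (K : ℕ) (l : List ℕ) (r : Ledger) : Prop where
  last_le : r.last ≤ l.length
  oddPart_last : oddPart r.last ≤ K
  le_last : ∀ t ≤ l.length, oddPart t ≤ K → t ≤ r.last
  est_le : ∀ t ≤ l.length, oddPart t ≤ K → ∀ x, r.est t x ≤ (l.take t).countP (· < x)
  le_est : ∀ t ≤ l.length, oddPart t ≤ K → ∀ x, (l.take t).countP (· < x) ≤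
    r.est t x + (Nat.log 2 (oddPart t) + 1) * (t / (K * depth K))

lemma Ledger.tracks_nil (K : ℕ) : Ledger.Tracks K [] ⟨0, fun _ _ => 0⟩ where
  last_le := le_rfl
  oddPart_last := by simp
  le_last := fun t ht _ => ht
  est_le := by simp
  le_est := by simp

namespace Ledger.Tracks

variable {K : ℕ} {l : List ℕ} {r : Ledger} {a : ℕ}

lemma concat_of_not_le (h : Ledger.Tracks K l r) (ha : ¬ oddPart (l.length + 1) ≤ K) :
    Ledger.Tracks K (l ++ [a]) r := by
  -- The new time is not a reporting time, so there is nothing new to estimate.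
  have key : ∀ t ≤ (l ++ [a]).length, oddPart t ≤ K → t ≤ l.length := by
    intro t ht ho
    rw [List.length_append, List.length_singleton] at ht
    rcases Nat.lt_or_ge l.length t with h1 | h1
    · exact absurd ((show t = l.length + 1 by omega) ▸ ho) ha
    · exact h1
  refine ⟨h.last_le.trans (by simp), h.oddPart_last, ?_, ?_, ?_⟩
  · exact fun t ht ho => h.le_last t (key t ht ho) ho
  · intro t ht ho
    rw [List.take_append_of_le_length (key t ht ho)]
    exact h.est_le t (key t ht ho) ho
  · intro t ht ho
    rw [List.take_append_of_le_length (key t ht ho)]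
    exact h.le_est t (key t ht ho) ho

lemma concat_of_le (h : Ledger.Tracks K l r) (ha : oddPart (l.length + 1) ≤ K) :
    Ledger.Tracks K (l ++ [a]) (r.receive K ((l.length + 1) :: sample (grain K (l.length + 1))
      ((l ++ [a]).drop (l.length + 1 - lowPart (l.length + 1))))) := by
  set n := l.length + 1 with hn
  have hlen : (l ++ [a]).length = n := by simp [hn]
  -- The parent of `n`, which is either `0` or an earlier reporting time.
  set s := n - lowPart n with hs
  have hpos := lowPart_pos n
  have hsl : s ≤ l.length := by omega
  have hsn : s ≤ n := by omega
  have hso := oddPart_sub_lowPart_le n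
  rw [← hs] at hso
  have hsK : oddPart s ≤ K := by omega
  have old : ∀ t ≤ n, t ≠ n → t ≤ l.length := by intro t; omega
  have split : ∀ x, (l ++ [a]).countP (· < x) =
      (l.take s).countP (· < x) + ((l ++ [a]).drop s).countP (· < x) := by
    intro x
    conv_lhs => rw [← List.take_append_drop s (l ++ [a])]
    rw [List.countP_append, List.take_append_of_le_length hsl]
  have hg : 0 < grain K n := Nat.succ_pos _
  refine ⟨hlen.ge, ha, fun t ht _ => hlen ▸ ht, ?_, ?_⟩
  · intro t ht ho x
    rw [hlen] at ht
    by_cases htn : t = n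
    · subst htn
      simp only [receive, Function.update_self]
      rw [countP_sample hg, List.take_of_length_le hlen.le, split, ← hs]
      exact Nat.add_le_add (h.est_le s hsl hsK x) (Nat.mul_div_le _ _)
    · simp only [receive, Function.update_of_ne htn]
      rw [List.take_append_of_le_length (old t ht htn)]
      exact h.est_le t (old t ht htn) ho x
  · intro t ht ho x
    rw [hlen] at ht
    by_cases htn : t = n
    · subst htn
      simp only [receive, Function.update_self]
      rw [countP_sample hg, List.take_of_length_le hlen.le, split, ← hs]
      have h1 := h.le_est s hsl hsK x
      have h2 : (Nat.log 2 (oddPart s) + 1) * (s / (K * depth K)) ≤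
          Nat.log 2 (oddPart n) * (n / (K * depth K)) := by
        rcases Nat.eq_zero_or_pos s with h0 | h0
        · simp [h0]
        · have hodd := oddPart_pos h0
          have hlog : Nat.log 2 (oddPart s) + 1 ≤ Nat.log 2 (oddPart n) := by
            rw [← Nat.log_mul_base one_lt_two hodd.ne']
            exact Nat.log_mono_right (by omega)
          exact Nat.mul_le_mul hlog (Nat.div_le_div_right hsn)
      set b := ((l ++ [a]).drop s).countP (· < x)
      have h3 : b ≤ grain K n * (b / grain K n) + n / (K * depth K) := by
        have h4 := Nat.div_add_mod b (grain K n)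
        have h5 : b % grain K n < n / (K * depth K) + 1 := Nat.mod_lt b hg
        omega
      rw [add_one_mul]
      omega
    · simp only [receive, Function.update_of_ne htn]
      rw [List.take_append_of_le_length (old t ht htn)]
      exact h.le_est t (old t ht htn) ho x

lemma mul_length_le (h : Ledger.Tracks K l r) (hK : 0 < K) :
    K * l.length ≤ K * r.last + 2 * l.length := by
  obtain ⟨t, ht, ho, hd⟩ := exists_oddPart_le hK l.length
  have h1 := h.le_last t ht ho
  have h2 : K * l.length = K * t + K * (l.length - t) := by
    rw [← mul_add]; congr 1; omega
  have h3 : K * t ≤ K * r.last := Nat.mul_le_mul_left _ h1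
  omega

lemma est_last_le (h : Ledger.Tracks K l r) (x : ℕ) :
    r.est r.last x ≤ l.countP (· < x) :=
  (h.est_le _ h.last_le h.oddPart_last x).trans ((List.take_sublist _ _).countP_le)

/-- The error `3 n / K` consists of at most `2 n / K` items that arrived after the last report and an
error of at most `n / K` within the reported prefix. -/
lemma mul_countP_le (h : Ledger.Tracks K l r) (hK : 0 < K) (x : ℕ) :
    K * l.countP (· < x) ≤ K * r.est r.last x + 3 * l.length := by
  have h1 := h.le_est _ h.last_le h.oddPart_last x
  have h2 : l.countP (· < x) ≤ (l.take r.last).countP (· < x) + (l.length - r.last) := by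
    conv_lhs => rw [← List.take_append_drop r.last l]
    rw [List.countP_append, ← List.length_drop]
    exact Nat.add_le_add_left List.countP_le_length _
  have h3 : Nat.log 2 (oddPart r.last) + 1 ≤ depth K :=
    Nat.succ_le_succ (Nat.log_mono_right h.oddPart_last)
  have h4 : K * ((Nat.log 2 (oddPart r.last) + 1) * (r.last / (K * depth K))) ≤ r.last :=
    calc _ ≤ K * (depth K * (r.last / (K * depth K))) := by gcongr
      _ = K * depth K * (r.last / (K * depth K)) := by ring
      _ ≤ r.last := Nat.mul_div_le _ _
  have h5 := h.mul_length_le hK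
  have h6 := h.last_le
  have h7 : K * (l.length - r.last) ≤ 2 * l.length := by
    rw [Nat.mul_sub]; omega
  calc K * l.countP (· < x)
      ≤ K * (r.est r.last x + (Nat.log 2 (oddPart r.last) + 1) * (r.last / (K * depth K))
          + (l.length - r.last)) := by gcongr; omega
    _ ≤ K * r.est r.last x + 3 * l.length := by rw [mul_add, mul_add]; omega

end Ledger.Tracks

/-! ### The protocol -/

open Classical in
/-- The one-way protocol with parameter `K`: sites store their local streams and send reports, and
the coordinator keeps one ledger per site and never sends anything. The quantile is the largest `x`
whose estimated rank is at most `φ` times the estimated number of items; the value `0` in the other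
case is never used, since the estimated rank of `0` is `0`. -/
noncomputable def tracker (K k u : ℕ) (hu : 0 < u) : Protocol k u where
  Site := List ℕ
  Coord := Fin k → Ledger
  siteInit _ := []
  coordInit _ := ⟨0, fun _ _ => 0⟩
  observe _ l a := (l ++ [a.val], report K (l ++ [a.val]))
  react c j w := .done (Function.update c j ((c j).receive K w))
  answer _ l _ := (l, none)
  rank c x := ∑ j, ((c j).est (c j).last x : ℝ)
  quantile c φ :=
    if h : ∃ x : Fin u, (∑ j, ((c j).est (c j).last x : ℝ)) ≤ φ * ∑ j, ((c j).last : ℝ) ∧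
        ∀ y, x < y → φ * ∑ j, ((c j).last : ℝ) < ∑ j, ((c j).est (c j).last y : ℝ)
    then h.choose else ⟨0, hu⟩

/-- The items observed by site `j`, in the order of their arrival. -/
def localItems {k u : ℕ} (j : Fin k) (A : List (Fin k × Fin u)) : List ℕ :=
  (A.filter (·.1 = j)).map (·.2.val)

lemma localItems_concat {k u : ℕ} (j : Fin k) (A : List (Fin k × Fin u)) (a : Fin k × Fin u) :
    localItems j (A ++ [a]) =
      if a.1 = j then localItems j A ++ [a.2.val] else localItems j A := by
  unfold localItems
  by_cases h : a.1 = j <;> simp [h]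

lemma sum_countP_localItems {k u : ℕ} (A : List (Fin k × Fin u)) (p : ℕ → Bool) :
    ∑ j, (localItems j A).countP p = A.countP (fun a => p a.2.val) := by
  induction A using List.reverseRecOn with
  | nil => simp [localItems]
  | append_singleton A a ih =>
    have h : ∀ j, (localItems j (A ++ [a])).countP p = (localItems j A).countP p +
        if a.1 = j then (if p a.2.val then 1 else 0) else 0 := by
      intro j
      rw [localItems_concat]
      split_ifs <;> simp [*]
    simp only [h, Finset.sum_add_distrib, ih, List.countP_append]
    simp [List.countP_singleton]

lemma sum_length_localItems {k u : ℕ} (A : List (Fin k × Fin u)) :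
    ∑ j, (localItems j A).length = A.length := by
  simpa using sum_countP_localItems A (fun _ => true)

lemma length_localItems_le {k u : ℕ} (j : Fin k) (A : List (Fin k × Fin u)) :
    (localItems j A).length ≤ A.length := by
  simpa [localItems] using List.length_filter_le _ A

section run

variable {K k u : ℕ} {hu : 0 < u}

lemma tracker_run_concat (A : List (Fin k × Fin u)) (a : Fin k × Fin u) :
    (tracker K k u hu).run (A ++ [a]) =
      (tracker K k u hu).step ((tracker K k u hu).run A) a := by
  simp [Protocol.run, List.foldl_append]

/-- The ledgers after site `j` has sent the given report, if any. -/
def postReport (K : ℕ) (c : Fin k → Ledger) (j : Fin k) : Option Msg → Fin k → Ledger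
  | none => c
  | some w => Function.update c j ((c j).receive K w)

lemma tracker_step (c : (tracker K k u hu).Config) (a : Fin k × Fin u) {l : List ℕ}
    (hl : c.site a.1 = l) :
    (tracker K k u hu).step c a =
      ⟨postReport K c.coord a.1 (report K (l ++ [a.2.val])),
        Function.update c.site a.1 (l ++ [a.2.val] : List ℕ),
        c.sent ++ (report K (l ++ [a.2.val])).toList⟩ := by
  have h : (tracker K k u hu).step c a = match report K (l ++ [a.2.val]) with
      | none => ⟨c.coord, Function.update c.site a.1 (l ++ [a.2.val] : List ℕ), c.sent⟩
      | some w => ⟨postReport K c.coord a.1 (some w),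
          Function.update c.site a.1 (l ++ [a.2.val] : List ℕ), c.sent ++ [w]⟩ := by
    subst hl
    rfl
  rw [h]
  cases report K (l ++ [a.2.val]) with
  | none => simp [postReport]
  | some w => simp

lemma tracker_site (A : List (Fin k × Fin u)) (j : Fin k) :
    ((tracker K k u hu).run A).site j = localItems j A := by
  induction A using List.reverseRecOn generalizing j with
  | nil => rfl
  | append_singleton A a ih =>
    rw [tracker_run_concat, tracker_step _ _ (ih a.1), localItems_concat]
    by_cases h : a.1 = j
    · subst h
      rw [if_pos rfl]
      exact Function.update_self ..
    · rw [if_neg h]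
      exact (Function.update_of_ne (Ne.symm h) _ _).trans (ih j)

lemma tracker_sent_concat (A : List (Fin k × Fin u)) (a : Fin k × Fin u) :
    ((tracker K k u hu).run (A ++ [a])).sent = ((tracker K k u hu).run A).sent ++
      (report K (localItems a.1 A ++ [a.2.val])).toList := by
  rw [tracker_run_concat, tracker_step _ _ (tracker_site A a.1)]

lemma tracks_postReport {c : Fin k → Ledger} {j : Fin k} {l : List ℕ}
    (h : Ledger.Tracks K l (c j)) (a : ℕ) :
    Ledger.Tracks K (l ++ [a]) (postReport K c j (report K (l ++ [a])) j) := by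
  by_cases ho : oddPart (l.length + 1) ≤ K
  · simpa [report, postReport, ho] using h.concat_of_le (a := a) ho
  · simpa [report, postReport, ho] using h.concat_of_not_le (a := a) ho

lemma tracks_postReport_of_ne {c : Fin k → Ledger} {i j : Fin k} {l : List ℕ}
    (h : Ledger.Tracks K l (c j)) (hij : i ≠ j) (m : Option Msg) :
    Ledger.Tracks K l (postReport K c i m j) := by
  cases m with
  | none => exact h
  | some w => simpa [postReport, Function.update_of_ne hij.symm] using h

lemma tracker_tracks (A : List (Fin k × Fin u)) (j : Fin k) :
    Ledger.Tracks K (localItems j A) (((tracker K k u hu).run A).coord j) := by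
  induction A using List.reverseRecOn generalizing j with
  | nil => exact Ledger.tracks_nil K
  | append_singleton A a ih =>
    rw [tracker_run_concat, tracker_step _ _ (tracker_site A a.1), localItems_concat]
    by_cases h : a.1 = j
    · subst h
      rw [if_pos rfl]
      exact tracks_postReport (ih a.1) _
    · rw [if_neg h]
      exact tracks_postReport_of_ne (ih j) h _

lemma tracker_wordsFit : (tracker K k u hu).WordsFit := by
  intro A
  induction A using List.reverseRecOn with
  | nil => intro w hw; simp [Protocol.run, Protocol.init] at hw
  | append_singleton A a ih =>
    intro w hw b hb
    rw [tracker_sent_concat, List.mem_append] at hw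
    rcases hw with hw | hw
    · exact (ih w hw b hb).trans (max_le_max le_rfl (by simp))
    · have hlen := length_localItems_le a.1 A
      have hitem : ∀ y ∈ localItems a.1 A ++ [a.2.val], y ≤ u := by
        intro y hy
        simp only [localItems, List.mem_append, List.mem_map, List.mem_singleton] at hy
        rcases hy with ⟨c, -, rfl⟩ | rfl
        · exact c.2.isLt.le
        · exact a.2.isLt.le
      unfold report at hw
      split_ifs at hw with ho
      · simp only [Option.toList_some, List.mem_singleton] at hw
        subst hw
        rcases List.mem_cons.1 hb with rfl | hb
        · simp; right; exact hlen
        · exact le_max_of_le_left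
            (mem_sample (fun y hy => hitem y (List.mem_of_mem_drop hy)) hb)
      · simp at hw

end run

/-! ### Quantiles from rank estimates -/

/-- Let `R` estimate ranks and `S` the number of items, both from below. The largest `x` with
`R x ≤ φ * S` is an approximate `φ`-quantile: its rank is not much larger than `φ |M|`, and the rank
of its successor is not much smaller. -/
lemma isApproxQuantile_of_rank_estimates {u : ℕ} {ε φ : ℝ} (hε : 0 ≤ ε) (hφ0 : 0 ≤ φ)
    (hφ1 : φ ≤ 1) {M : Multiset (Fin u)} {R : Fin u → ℝ} {S : ℝ}
    (hR : ∀ x, R x ≤ rankIn M x) (hR' : ∀ x, rankIn M x ≤ R x + ε * M.card)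
    (hS : S ≤ M.card) (hS' : M.card ≤ S + ε * M.card) {x : Fin u}
    (hx : R x ≤ φ * S) (hmax : ∀ y, x < y → φ * S < R y) : IsApproxQuantile ε M φ x := by
  rcases Nat.eq_zero_or_pos M.card with h0 | h0
  · obtain rfl := Multiset.card_eq_zero.1 h0
    exact ⟨φ, hφ0, hφ1, by linarith, by linarith, by simp [IsQuantile]⟩
  set n : ℝ := (Multiset.card M : ℝ) with hn
  have hn0 : 0 < n := by rw [hn]; exact_mod_cast h0
  set g : ℝ := (M.countP (fun y => x < y) : ℝ) with hg
  set a : ℝ := (M.countP (fun y => y < x) : ℝ) with ha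
  have ha' : a = rankIn M x := rfl
  have hle : (M.countP (fun y => y ≤ x) : ℝ) + g = n := by
    have h := Multiset.card_eq_countP_add_countP (fun y => y ≤ x) M
    simp only [not_le] at h
    rw [hn, h, hg]
    push_cast
    ring
  have hag : a + g ≤ n := by
    have h : M.countP (fun y => y < x) ≤ M.countP (fun y => y ≤ x) := by
      rw [Multiset.countP_eq_card_filter, Multiset.countP_eq_card_filter]
      exact Multiset.card_le_card (Multiset.monotone_filter_right M fun y hy => hy.le)
    have h' : a ≤ (M.countP (fun y => y ≤ x) : ℝ) := by rw [ha]; exact_mod_cast h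
    linarith
  -- `|M| - g` is the rank of the successor of `x`, or `|M|` if `x` is the largest element.
  have hlow : (φ - ε) * n ≤ n - g := by
    by_cases hux : x.val + 1 < u
    · have hxy : x < ⟨x.val + 1, hux⟩ := Fin.lt_def.2 (Nat.lt_succ_self _)
      have hrank : rankIn M ⟨x.val + 1, hux⟩ = M.countP (fun y => y ≤ x) := by
        unfold rankIn
        refine Multiset.countP_congr rfl fun y _ => ?_
        rw [Fin.lt_def, Fin.le_def, Nat.lt_succ_iff]
      have h1 := hmax _ hxy
      have h2 := hR ⟨x.val + 1, hux⟩
      rw [hrank] at h2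
      nlinarith
    · have hg0 : g = 0 := by
        rw [hg, Nat.cast_eq_zero, Multiset.countP_eq_zero]
        intro y _ hy
        have := y.isLt
        have := Fin.lt_def.1 hy
        omega
      rw [hg0]
      nlinarith
  have hup : a ≤ (φ + ε) * n := by
    have h1 := hR' x
    have h2 : φ * S ≤ φ * n := mul_le_mul_of_nonneg_left hS hφ0
    rw [ha']
    linarith
  have hg0 : 0 ≤ g := Nat.cast_nonneg _
  have ha0 : 0 ≤ a := Nat.cast_nonneg _
  refine ⟨max (φ - ε) (a / n), le_max_of_le_right (by positivity), max_le (by linarith) ?_,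
    le_max_left _ _, max_le (by linarith) ?_, ?_, ?_⟩
  · rw [div_le_one hn0]; linarith
  · rwa [div_le_iff₀ hn0]
  · calc a = a / n * n := by field_simp
      _ ≤ _ := by gcongr; exact le_max_right _ _
  · have h : max (φ - ε) (a / n) * n ≤ n - g := by
      rw [max_mul_of_nonneg _ _ hn0.le, div_mul_cancel₀ _ hn0.ne']
      exact max_le hlow (by linarith)
    change g ≤ (1 - max (φ - ε) (a / n)) * n
    linarith

/-! ### Accuracy of the protocol -/

section accuracy

variable {K k u : ℕ} {hu : 0 < u} {ε : ℝ}

lemma rankIn_items (A : List (Fin k × Fin u)) (x : Fin u) :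
    rankIn (items A) x = ∑ j, (localItems j A).countP (· < x.val) := by
  rw [sum_countP_localItems A (fun y => decide (y < x.val))]
  simp [rankIn, items, List.countP_map, Function.comp_def]

lemma card_items (A : List (Fin k × Fin u)) : (items A).card = A.length := by simp [items]

lemma tracker_rank_le (A : List (Fin k × Fin u)) (x : Fin u) :
    (tracker K k u hu).rank ((tracker K k u hu).run A).coord x ≤ rankIn (items A) x := by
  rw [rankIn_items, Nat.cast_sum]
  exact Finset.sum_le_sum (s := Finset.univ)
    (f := fun j => ((((tracker K k u hu).run A).coord j).est
      (((tracker K k u hu).run A).coord j).last x : ℝ))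
    fun j _ => (Nat.cast_le (α := ℝ)).2 ((tracker_tracks A j).est_last_le x.val)

lemma le_tracker_rank (hK : 3 ≤ ε * K) (hε : 0 < ε) (A : List (Fin k × Fin u)) (x : Fin u) :
    (rankIn (items A) x : ℝ) ≤
      (tracker K k u hu).rank ((tracker K k u hu).run A).coord x + ε * (items A).card := by
  have hK0 : (0 : ℝ) < K := by by_contra! h; nlinarith
  rw [rankIn_items, card_items, ← sum_length_localItems A, Nat.cast_sum, Nat.cast_sum,
    Finset.mul_sum]
  refine le_trans (Finset.sum_le_sum fun j _ => ?_) Finset.sum_add_distrib.le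
  have h : ((K * (localItems j A).countP (· < x.val) : ℕ) : ℝ) ≤ _ :=
    (Nat.cast_le (α := ℝ)).2 ((tracker_tracks (hu := hu) A j).mul_countP_le (by exact_mod_cast hK0) x.val)
  push_cast at h
  have h' := mul_le_mul_of_nonneg_right hK (Nat.cast_nonneg (α := ℝ) (localItems j A).length)
  refine le_of_mul_le_mul_left ?_ hK0
  rw [mul_add]
  linarith

lemma tracker_sum_last_le (A : List (Fin k × Fin u)) :
    ∑ j, ((((tracker K k u hu).run A).coord j).last : ℝ) ≤ (items A).card := by
  rw [card_items, ← sum_length_localItems A, Nat.cast_sum]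
  exact Finset.sum_le_sum fun j _ => (Nat.cast_le (α := ℝ)).2 (tracker_tracks A j).last_le

lemma card_le_tracker_sum_last (hK : 3 ≤ ε * K) (hε : 0 < ε) (A : List (Fin k × Fin u)) :
    ((items A).card : ℝ) ≤
      ∑ j, ((((tracker K k u hu).run A).coord j).last : ℝ) + ε * (items A).card := by
  have hK0 : (0 : ℝ) < K := by by_contra! h; nlinarith
  rw [card_items, ← sum_length_localItems A, Nat.cast_sum, Finset.mul_sum]
  refine le_trans (Finset.sum_le_sum fun j _ => ?_) Finset.sum_add_distrib.le
  have h : ((K * (localItems j A).length : ℕ) : ℝ) ≤ _ :=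
    (Nat.cast_le (α := ℝ)).2 ((tracker_tracks (hu := hu) A j).mul_length_le (by exact_mod_cast hK0))
  push_cast at h
  have h0 := Nat.cast_nonneg (α := ℝ) (localItems j A).length
  have h' := mul_le_mul_of_nonneg_right hK h0
  refine le_of_mul_le_mul_left ?_ hK0
  rw [mul_add]
  linarith

lemma tracker_tracksRanks (hK : 3 ≤ ε * K) (hε : 0 < ε) :
    (tracker K k u hu).TracksRanks ε := by
  intro A t _ x
  have h1 := tracker_rank_le (K := K) (hu := hu) (A.take t) x
  have h2 := le_tracker_rank (hu := hu) hK hε (A.take t) x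
  rw [abs_sub_le_iff]
  constructor
  · have : 0 ≤ ε * ((items (A.take t)).card : ℝ) := by positivity
    linarith
  · linarith

lemma tracker_tracksQuantiles (hK : 3 ≤ ε * K) (hε : 0 < ε) :
    (tracker K k u hu).TracksQuantiles ε := by
  intro A t _ φ hφ0 hφ1
  set B := A.take t
  set c := ((tracker K k u hu).run B).coord with hc
  have hrank : ∀ x, (tracker K k u hu).rank c x = ∑ j, ((c j).est (c j).last x : ℝ) := fun _ => rfl
  have hex : ∃ x : Fin u,
      (∑ j, ((c j).est (c j).last x : ℝ)) ≤ φ * ∑ j, ((c j).last : ℝ) ∧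
        ∀ y, x < y → φ * ∑ j, ((c j).last : ℝ) < ∑ j, ((c j).est (c j).last y : ℝ) := by
    set s := Finset.univ.filter fun x : Fin u =>
      (∑ j, ((c j).est (c j).last x : ℝ)) ≤ φ * ∑ j, ((c j).last : ℝ) with hs
    have hne : s.Nonempty := by
      refine ⟨⟨0, hu⟩, Finset.mem_filter.2 ⟨Finset.mem_univ _, ?_⟩⟩
      have h := tracker_rank_le (K := K) (hu := hu) B ⟨0, hu⟩
      rw [← hc, hrank] at h
      have h0 : rankIn (items B) ⟨0, hu⟩ = 0 := by
        simp [rankIn, Fin.lt_def]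
      rw [h0, Nat.cast_zero] at h
      exact h.trans (by positivity)
    refine ⟨s.max' hne, (Finset.mem_filter.1 (s.max'_mem hne)).2, fun y hy => ?_⟩
    by_contra! hle
    exact hy.not_ge (s.le_max' y (Finset.mem_filter.2 ⟨Finset.mem_univ _, hle⟩))
  have hq : (tracker K k u hu).quantile c φ = hex.choose := dif_pos hex
  rw [hq]
  exact isApproxQuantile_of_rank_estimates hε.le hφ0 hφ1
    (fun x => tracker_rank_le (K := K) (hu := hu) B x) (fun x => le_tracker_rank hK hε B x)
    (tracker_sum_last_le B) (card_le_tracker_sum_last hK hε B)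
    hex.choose_spec.1 hex.choose_spec.2

end accuracy

/-! ### Cost of the protocol -/

section cost

variable {K k u : ℕ} {hu : 0 < u}

/-- The number of words that a site sends at local time `t`. -/
def reportCost (K t : ℕ) : ℕ :=
  if oddPart t ≤ K then 1 + lowPart t / grain K t else 0

lemma totalCost_report (K : ℕ) {l : List ℕ} (hl : 0 < l.length) :
    totalCost (report K l).toList = reportCost K l.length := by
  unfold report reportCost
  split_ifs with h
  · have := lowPart_le hl
    simp only [totalCost, Msg.cost, Option.toList_some, List.map_cons, List.map_nil,
      List.sum_cons, List.sum_nil, List.length_cons, length_sample, List.length_drop]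
    rw [show l.length - (l.length - lowPart l.length) = lowPart l.length by omega]
    generalize lowPart l.length / grain K l.length = m
    omega
  · rfl

lemma tracker_cost (A : List (Fin k × Fin u)) :
    (tracker K k u hu).cost A =
      ∑ j, ∑ t ∈ Finset.range (localItems j A).length, reportCost K (t + 1) := by
  induction A using List.reverseRecOn with
  | nil => simp [Protocol.cost, Protocol.run, Protocol.init, totalCost, localItems]
  | append_singleton A a ih =>
    have h : ∀ j, ∑ t ∈ Finset.range (localItems j (A ++ [a])).length, reportCost K (t + 1) =
        ∑ t ∈ Finset.range (localItems j A).length, reportCost K (t + 1) +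
          if a.1 = j then reportCost K ((localItems j A).length + 1) else 0 := by
      intro j
      rw [localItems_concat]
      split_ifs
      · rw [List.length_append, List.length_singleton, Finset.sum_range_succ]
      · rfl
    have hr := totalCost_report K (l := localItems a.1 A ++ [a.2.val]) (by simp)
    rw [List.length_append, List.length_singleton] at hr
    simp only [h, Finset.sum_add_distrib]
    rw [← ih, Finset.sum_ite_eq, if_pos (Finset.mem_univ _), ← hr]
    simp [Protocol.cost, tracker_sent_concat, totalCost]

lemma reportCost_le {t : ℕ} (ht : 0 < t) (hK : 0 < K) (ho : oddPart t ≤ K) :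
    (reportCost K t : ℝ) ≤ 1 + K * depth K * (oddPart t : ℝ)⁻¹ := by
  have hD : 0 < depth K := Nat.succ_pos _
  have hodd := oddPart_pos ht
  have hg : lowPart t * oddPart t ≤ K * depth K * grain K t :=
    (lowPart_mul_oddPart t).le.trans (Nat.lt_mul_div_succ t (by positivity)).le
  have hg' : (lowPart t : ℝ) * oddPart t ≤ K * depth K * grain K t := by
    exact_mod_cast hg
  have hg0 : (0 : ℝ) < grain K t := Nat.cast_pos.2 (Nat.succ_pos _)
  rw [reportCost, if_pos ho]
  push_cast
  gcongr
  refine Nat.cast_div_le.trans ?_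
  rw [div_le_iff₀ hg0, mul_right_comm, ← div_eq_mul_inv, le_div_iff₀ (by exact_mod_cast hodd)]
  exact hg'

/-- The cost of a single site: the reporting times `t ≤ n` inject into the pairs of an exponent at most
`log₂ n` and an odd part `o ≤ K`, and the cost for given `o` is at most `1 + K * depth K / o`. -/
lemma sum_reportCost_le (hK : 0 < K) (n : ℕ) :
    (∑ t ∈ Finset.range n, (reportCost K (t + 1) : ℝ)) ≤
      (Nat.log 2 n + 1) * (K + K * depth K * (1 + Real.log K)) := by
  set f : ℕ → ℝ := fun o => 1 + K * depth K * (o : ℝ)⁻¹ with hf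
  have hf0 : ∀ o, 0 ≤ f o := fun o => by positivity
  set s := (Finset.range n).filter fun t => oddPart (t + 1) ≤ K with hs
  set e : ℕ → ℕ × ℕ := fun t => ((t + 1).factorization 2, oddPart (t + 1)) with he
  have hinj : Set.InjOn e s := by
    intro t _ t' _ h
    simp only [he, Prod.mk.injEq] at h
    have h1 := lowPart_mul_oddPart (t + 1)
    have h2 := lowPart_mul_oddPart (t' + 1)
    unfold lowPart at h1 h2
    rw [h.1, h.2] at h1
    omega
  have hsub : s.image e ⊆ Finset.range (Nat.log 2 n + 1) ×ˢ Finset.Icc 1 K := by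
    intro p hp
    obtain ⟨t, ht, rfl⟩ := Finset.mem_image.1 hp
    obtain ⟨ht, ho⟩ := Finset.mem_filter.1 ht
    rw [Finset.mem_range] at ht
    have hlow : 2 ^ (t + 1).factorization 2 ≤ n := (lowPart_le t.succ_pos).trans ht
    refine Finset.mem_product.2 ⟨Finset.mem_range.2 (Nat.lt_succ_iff.2 ?_),
      Finset.mem_Icc.2 ⟨oddPart_pos t.succ_pos, ho⟩⟩
    exact Nat.le_log_of_pow_le one_lt_two hlow
  have hharm : ∑ o ∈ Finset.Icc 1 K, (o : ℝ)⁻¹ ≤ 1 + Real.log K := by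
    have h := harmonic_le_one_add_log K
    rw [harmonic_eq_sum_Icc] at h
    push_cast at h
    exact h
  calc (∑ t ∈ Finset.range n, (reportCost K (t + 1) : ℝ))
      = ∑ t ∈ s, (reportCost K (t + 1) : ℝ) := by
        rw [hs, Finset.sum_filter]
        refine Finset.sum_congr rfl fun t _ => ?_
        split_ifs with h
        · rfl
        · simp [reportCost, h]
    _ ≤ ∑ t ∈ s, f (e t).2 := Finset.sum_le_sum fun t ht =>
        reportCost_le t.succ_pos hK (Finset.mem_filter.1 ht).2
    _ = ∑ p ∈ s.image e, f p.2 := (Finset.sum_image (f := fun p => f p.2) hinj).symm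
    _ ≤ ∑ p ∈ Finset.range (Nat.log 2 n + 1) ×ˢ Finset.Icc 1 K, f p.2 :=
        Finset.sum_le_sum_of_subset_of_nonneg hsub fun p _ _ => hf0 p.2
    _ = (Nat.log 2 n + 1) * ∑ o ∈ Finset.Icc 1 K, f o := by
        rw [Finset.sum_product]; simp
    _ ≤ _ := by
        rw [hf, Finset.sum_add_distrib, ← Finset.mul_sum]
        simp only [Finset.sum_const, Nat.card_Icc, Nat.add_sub_cancel, nsmul_eq_mul, mul_one]
        gcongr

lemma tracker_cost_le (hK : 0 < K) (A : List (Fin k × Fin u)) :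
    ((tracker K k u hu).cost A : ℝ) ≤
      k * ((Nat.log 2 A.length + 1) * (K + K * depth K * (1 + Real.log K))) := by
  rw [tracker_cost]
  push_cast
  have hlog : 0 ≤ Real.log K := Real.log_natCast_nonneg K
  calc _ ≤ ∑ _j : Fin k, ((Nat.log 2 A.length + 1) * (K + K * depth K * (1 + Real.log K)) : ℝ) := by
        refine Finset.sum_le_sum fun j _ => (sum_reportCost_le hK _).trans ?_
        have h : Nat.log 2 (localItems j A).length ≤ Nat.log 2 A.length :=
          Nat.log_mono_right (length_localItems_le j A)
        gcongr
    _ = _ := by simp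

end cost

lemma natLog_two_mul_le {n : ℕ} (hn : n ≠ 0) : (Nat.log 2 n : ℝ) * Real.log 2 ≤ Real.log n := by
  rw [← Real.log_pow]
  exact Real.log_le_log (by positivity) (by exact_mod_cast Nat.pow_log_le_self 2 hn)

/-- The cost of a site in terms of `ε`: here `K = O(1 / ε)`, and `depth K` and `1 + log K` are
`O(log (1 / ε))`. -/
lemma budget_le {ε : ℝ} (hε : 0 < ε) (hε2 : ε ≤ 1 / 2) {K : ℕ} (hK0 : 0 < K)
    (hK : (K : ℝ) ≤ 4 / ε) {n : ℕ} (hn : 2 ≤ n) :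
    (Nat.log 2 n + 1) * (K + K * depth K * (1 + Real.log K)) ≤
      600 * (1 / ε * Real.log n * Real.log (1 / ε) ^ 2) := by
  set l := Real.log (1 / ε) with hl
  set L := Real.log n with hL
  have h2 : (0.69 : ℝ) < Real.log 2 := by linarith [Real.log_two_gt_d9]
  have hl2 : Real.log 2 ≤ l :=
    Real.log_le_log two_pos (by rw [le_div_iff₀ hε]; linarith)
  have hL2 : Real.log 2 ≤ L := Real.log_le_log two_pos (by exact_mod_cast hn)
  have hlogK : Real.log K ≤ 3 * l := by
    have h4 : Real.log 4 = 2 * Real.log 2 := by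
      rw [show (4 : ℝ) = 2 ^ 2 by norm_num, Real.log_pow]; norm_num
    calc Real.log K ≤ Real.log (4 * (1 / ε)) :=
          Real.log_le_log (by exact_mod_cast hK0) (by rwa [mul_one_div])
      _ = Real.log 4 + l := Real.log_mul (by norm_num) (by positivity)
      _ ≤ 3 * l := by linarith
  have hD : (depth K : ℝ) ≤ 6 * l := by
    have h := natLog_two_mul_le hK0.ne'
    have h0 : (0 : ℝ) ≤ Nat.log 2 K := Nat.cast_nonneg _
    unfold depth
    push_cast
    nlinarith
  have hn' : (Nat.log 2 n : ℝ) + 1 ≤ 3 * L := by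
    have h := natLog_two_mul_le (n := n) (by omega)
    have h0 : (0 : ℝ) ≤ Nat.log 2 n := Nat.cast_nonneg _
    nlinarith
  have hl0 : 0 < l := by linarith
  have hL0 : 0 < L := by linarith
  have hlogK0 : 0 ≤ Real.log K := Real.log_natCast_nonneg K
  have hinner : 1 + depth K * (1 + Real.log K) ≤ 50 * l ^ 2 := by
    calc 1 + depth K * (1 + Real.log K) ≤ 1 + 6 * l * (5 * l) := by
          gcongr; linarith
      _ ≤ 50 * l ^ 2 := by nlinarith
  calc (Nat.log 2 n + 1) * (K + K * depth K * (1 + Real.log K))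
      = (Nat.log 2 n + 1) * (K * (1 + depth K * (1 + Real.log K))) := by ring
    _ ≤ 3 * L * (4 / ε * (50 * l ^ 2)) := by gcongr
    _ = 600 * (1 / ε * L * l ^ 2) := by ring

end DistStream

theorem mainTheorem5 :
    ∃ C : ℝ, 0 < C ∧
      ∀ (k u : ℕ) (ε : ℝ), 2 ≤ k → 1 ≤ u → 0 < ε → ε ≤ 1 / 2 →
        ∃ P : DistStream.Protocol k u,
          P.TracksQuantiles ε ∧ P.TracksRanks ε ∧ P.WordsFit ∧
            ∀ A : List (Fin k × Fin u), 2 ≤ A.length →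
              (P.cost A : ℝ) ≤
                C * (k / ε * Real.log A.length * Real.log (1 / ε) ^ 2) := by
  refine ⟨600, by norm_num, fun k u ε _ hu hε hε2 => ?_⟩
  set K := ⌈3 / ε⌉₊ with hKdef
  have hK0 : 0 < K := Nat.ceil_pos.2 (by positivity)
  have hK : 3 ≤ ε * K := by
    have h := Nat.le_ceil (3 / ε)
    rwa [div_le_iff₀' hε] at h
  have hK4 : (K : ℝ) ≤ 4 / ε := by
    have h := (Nat.ceil_lt_add_one (show 0 ≤ 3 / ε by positivity)).le
    have h1 : 1 ≤ 1 / ε := by rw [le_div_iff₀ hε]; linarith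
    calc (K : ℝ) ≤ 3 / ε + 1 := h
      _ ≤ 3 / ε + 1 / ε := by gcongr
      _ = 4 / ε := by ring
  refine ⟨DistStream.tracker K k u hu, DistStream.tracker_tracksQuantiles hK hε,
    DistStream.tracker_tracksRanks hK hε, DistStream.tracker_wordsFit, fun A hA => ?_⟩
  calc ((DistStream.tracker K k u hu).cost A : ℝ) ≤ _ := DistStream.tracker_cost_le hK0 A
    _ ≤ k * (600 * (1 / ε * Real.log A.length * Real.log (1 / ε) ^ 2)) := by
        exact mul_le_mul_of_nonneg_left (DistStream.budget_le hε hε2 hK0 hK4 hA) k.cast_nonneg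
    _ = _ := by ring
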